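/- Let $\mathbb O$ be the octonions with standard basis $e_0=1,e_1,\dots,e_7$. A (unital) $\mathbb O$-bimodule is a real vector space $M$ with real-bilinear left and right multiplications by octonions such that $1x=x=x1$ and $[p,q,x]=[q,x,p]=[x,p,q]=-[q,p,x]$ for all $p,q\in\mathbb O$, $x\in M$, where $[a,b,c]=(ab)c-a(bc)$. Put $\operatorname{Re}M=\{m\in M:[p,q,m]=0\ \forall p,q\in\mathbb O\}$, with the real part operator $\operatorname{Re}m=\frac5{12}m-\frac1{12}\sum_{i=1}^7e_ime_i$. A real-linear map $f:M\to M'$ between $\mathbb O$-bimodules is right para-linear if $\operatorname{Re}B_p(f,x)=0$ for all $p\in\mathbb O$, $x\in M$, where $B_p(f,x)=f(x)p-f(xp)$. A Hilbert $\mathbb O$-bimodule is an $\mathbb O$-bimodule $H$ with a real-bilinear map $\langle\cdot,\cdot\rangle:H\times H\to\mathbb O$ such that each $\langle u,\cdot\rangle$ is right para-linear, $\langle u,v\rangle=\overline{\langle v,u\rangle}$, $\langle u,u\rangle$ is a nonnegative real that vanishes only for $u=0$, and $H$ is complete for $\|u\|=\sqrt{\langle u,u\rangle}$. The slice cone is $\mathbb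 C(H)=\bigcup_J(\operatorname{Re}H+J\operatorname{Re}H)$, $J$ running over the imaginary octonions with $|J|=1$. Write $B_p(u,v)=\langle u,v\rangle p-\langle u,vp\rangle$. A family $(x_\alpha)$ in $H$ is orthonormal if $\langle x_\alpha,x_\beta\rangle=\delta_{\alpha\beta}$, weak associative orthonormal if moreover $B_p(x_\alpha,x_\beta)=0$ for all $p,\alpha,\beta$, and a weak associative orthonormal basis if it is maximal among weak associative orthonormal families. Let $T:H\to H$ be bounded and real-linear. Its adjoint $T^*$ is determined by the condition that, for every $y\in H$, $\langle T^*y,\cdot\rangle$ is the unique right para-linear map with $\operatorname{Re}\langle T^*y,x\rangle=\operatorname{Re}\langle y,Tx\rangle$ for all $x\in H$; $T$ is self-adjoint if $T=T^*$. For $\lambda\in\mathbb O$ let $E_\lambda(T)=\{x\in H:Tx=x\lambda\}$; $\lambda$ is an eigenvalue if $E_\lambda(T)\ne\{0\}$. A strong eigenvector for $\lambda$ is a nonzero $z\in\mathbb C(H)$ with $Tz=z\lambda$. The number $\lambda$ is a standard strong eigenvalue if it has a strong eigenvector and there is an orthonormal system $\{z_i\}$ of strong eigenvectors for $\lambda$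 such that $E_\lambda(T)$ is contained in the closure of the set of finite sums $\sum_k z_{i_k}p_k$, $p_k\in\mathbb O$. Theorem (Hilbert-Schmidt). Let $H$ be a Hilbert $\mathbb O$-bimodule and let $T:H\to H$ be a bounded, compact, self-adjoint, right para-linear operator such that every real eigenvalue of $T$ is a standard strong eigenvalue. Then $H$ has a weak associative orthonormal basis $\{z_i\}_{i\in\mathcal N}\cup\{z_\alpha\}_{\alpha\in\Lambda}$ of strong eigenvectors of $T$ (so all of them lie in $\mathbb C(H)$) such that: 1. $\mathcal N$ is finite or countable, $Tz_i=\lambda_iz_i$ with $\lambda_i\in\mathbb R\setminus\{0\}$ for $i\in\mathcal N$, and $\lambda_i\to0$ if $\mathcal N$ is infinite; 2. $Tz_\alpha=0$ for $\alpha\in\Lambda$; 3. each $P_{z_i}(x)=z_i\langle z_i,x\rangle$ is a right para-linear map with $P_{z_i}(P_{z_i}x)=P_{z_i}x$, and for every $x\in H$ $$Tx=\sum_{i\in\mathcal N}\lambda_iP_{z_i}x,$$ where the series converges (unconditionally) in the norm of $H$. -/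

import Mathlib

open Filter Topology

universe u

/-- The octonions, as real coordinate vectors with respect to the standard basis
`1 = e₀, e₁, …, e₇`. The multiplication (defined below) is *not* the pointwise one. -/
def Octonion : Type := Fin 8 → ℝ

namespace Octonion

noncomputable instance : AddCommGroup Octonion := inferInstanceAs (AddCommGroup (Fin 8 → ℝ))

noncomputable instance : Module ℝ Octonion := inferInstanceAs (Module ℝ (Fin 8 → ℝ))

@[ext] theorem ext {x y : Octonion} (h : ∀ i : Fin 8, x i = y i) : x = y := funext h

@[simp] theorem zero_apply (i : Fin 8) : (0 : Octonion) i = 0 := rfl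
@[simp] theorem add_apply (x y : Octonion) (i : Fin 8) : (x + y) i = x i + y i := rfl
@[simp] theorem neg_apply (x : Octonion) (i : Fin 8) : (-x) i = -(x i) := rfl
@[simp] theorem sub_apply (x y : Octonion) (i : Fin 8) : (x - y) i = x i - y i := rfl
@[simp] theorem smul_apply (r : ℝ) (x : Octonion) (i : Fin 8) : (r • x) i = r * x i := rfl

/-- The standard basis vectors `e₀ = 1, e₁, …, e₇`. -/
def e (k : Fin 8) : Octonion := fun i => if i = k then 1 else 0

noncomputable instance : One Octonion := ⟨e 0⟩

/-- The bilinear multiplication with unit `e₀`, `eᵢ eᵢ = -1`, and `eᵢ eⱼ = eₖ = - eⱼ eᵢ` for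
`(i, j, k)` a cyclic rotation of one of the oriented triples
`(123), (145), (176), (246), (257), (347), (365)` of the Fano plane. -/
noncomputable instance : Mul Octonion where
  mul x y :=
   ![
     x 0 * y 0 - x 1 * y 1 - x 2 * y 2 - x 3 * y 3 - x 4 * y 4 - x 5 * y 5 - x 6 * y 6 - x 7 * y 7,
     x 0 * y 1 + x 1 * y 0 + x 2 * y 3 - x 3 * y 2 + x 4 * y 5 - x 5 * y 4 - x 6 * y 7 + x 7 * y 6,
     x 0 * y 2 - x 1 * y 3 + x 2 * y 0 + x 3 * y 1 + x 4 * y 6 + x 5 * y 7 - x 6 * y 4 - x 7 * y 5,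
     x 0 * y 3 + x 1 * y 2 - x 2 * y 1 + x 3 * y 0 + x 4 * y 7 - x 5 * y 6 + x 6 * y 5 - x 7 * y 4,
     x 0 * y 4 - x 1 * y 5 - x 2 * y 6 - x 3 * y 7 + x 4 * y 0 + x 5 * y 1 + x 6 * y 2 + x 7 * y 3,
     x 0 * y 5 + x 1 * y 4 - x 2 * y 7 + x 3 * y 6 - x 4 * y 1 + x 5 * y 0 - x 6 * y 3 + x 7 * y 2,
     x 0 * y 6 + x 1 * y 7 + x 2 * y 4 - x 3 * y 5 - x 4 * y 2 + x 5 * y 3 + x 6 * y 0 - x 7 * y 1,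
     x 0 * y 7 - x 1 * y 6 + x 2 * y 5 + x 3 * y 4 - x 4 * y 3 - x 5 * y 2 + x 6 * y 1 + x 7 * y 0]

/-- Conjugation `x₀ + ∑ xᵢ eᵢ ↦ x₀ - ∑ xᵢ eᵢ`. -/
def conj (x : Octonion) : Octonion := fun i => if i = 0 then x i else -(x i)

/-- `J` is an imaginary unit: `J ∈ Im 𝕆` and `|J|² = J * conj J = 1`. -/
def IsImagUnit (J : Octonion) : Prop := J 0 = 0 ∧ J * conj J = 1

theorem mul_apply0 (x y : Octonion) : (x * y) 0 =
    x 0 * y 0 - x 1 * y 1 - x 2 * y 2 - x 3 * y 3 - x 4 * y 4 - x 5 * y 5 - x 6 * y 6 - x 7 * y 7 := rfl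
theorem mul_apply1 (x y : Octonion) : (x * y) 1 =
    x 0 * y 1 + x 1 * y 0 + x 2 * y 3 - x 3 * y 2 + x 4 * y 5 - x 5 * y 4 - x 6 * y 7 + x 7 * y 6 := rfl
theorem mul_apply2 (x y : Octonion) : (x * y) 2 =
    x 0 * y 2 - x 1 * y 3 + x 2 * y 0 + x 3 * y 1 + x 4 * y 6 + x 5 * y 7 - x 6 * y 4 - x 7 * y 5 := rfl
theorem mul_apply3 (x y : Octonion) : (x * y) 3 =
    x 0 * y 3 + x 1 * y 2 - x 2 * y 1 + x 3 * y 0 + x 4 * y 7 - x 5 * y 6 + x 6 * y 5 - x 7 * y 4 := rfl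
theorem mul_apply4 (x y : Octonion) : (x * y) 4 =
    x 0 * y 4 - x 1 * y 5 - x 2 * y 6 - x 3 * y 7 + x 4 * y 0 + x 5 * y 1 + x 6 * y 2 + x 7 * y 3 := rfl
theorem mul_apply5 (x y : Octonion) : (x * y) 5 =
    x 0 * y 5 + x 1 * y 4 - x 2 * y 7 + x 3 * y 6 - x 4 * y 1 + x 5 * y 0 - x 6 * y 3 + x 7 * y 2 := rfl
theorem mul_apply6 (x y : Octonion) : (x * y) 6 =
    x 0 * y 6 + x 1 * y 7 + x 2 * y 4 - x 3 * y 5 - x 4 * y 2 + x 5 * y 3 + x 6 * y 0 - x 7 * y 1 := rfl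
theorem mul_apply7 (x y : Octonion) : (x * y) 7 =
    x 0 * y 7 - x 1 * y 6 + x 2 * y 5 + x 3 * y 4 - x 4 * y 3 - x 5 * y 2 + x 6 * y 1 + x 7 * y 0 := rfl

theorem one_apply (i : Fin 8) : (1 : Octonion) i = if i = 0 then 1 else 0 := rfl

theorem ext8 {x y : Octonion} (h0 : x 0 = y 0) (h1 : x 1 = y 1) (h2 : x 2 = y 2) (h3 : x 3 = y 3)
    (h4 : x 4 = y 4) (h5 : x 5 = y 5) (h6 : x 6 = y 6) (h7 : x 7 = y 7) : x = y := by
  ext i; fin_cases i <;> assumption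

theorem assoc_cycl (x y z : Octonion) :
    x * y * z - x * (y * z) = y * z * x - y * (z * x) := by
  apply ext8 <;> simp only [mul_apply0, mul_apply1, mul_apply2, mul_apply3, mul_apply4, mul_apply5, mul_apply6, mul_apply7, sub_apply] <;> ring

theorem assoc_swap (x y z : Octonion) :
    x * y * z - x * (y * z) = -(y * x * z - y * (x * z)) := by
  apply ext8 <;> simp only [mul_apply0, mul_apply1, mul_apply2, mul_apply3, mul_apply4, mul_apply5, mul_apply6, mul_apply7, sub_apply, neg_apply] <;> ring

theorem one_mul' (x : Octonion) : 1 * x = x := by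
  apply ext8 <;> simp [mul_apply0, mul_apply1, mul_apply2, mul_apply3, mul_apply4, mul_apply5, mul_apply6, mul_apply7, one_apply]

theorem mul_one' (x : Octonion) : x * 1 = x := by
  apply ext8 <;> simp [mul_apply0, mul_apply1, mul_apply2, mul_apply3, mul_apply4, mul_apply5, mul_apply6, mul_apply7, one_apply]

/-- Multiplication as a real bilinear map. -/
noncomputable def mulBilin : Octonion →ₗ[ℝ] Octonion →ₗ[ℝ] Octonion :=
  LinearMap.mk₂ ℝ (fun x y => x * y)
    (by intros; apply ext8 <;> simp only [mul_apply0, mul_apply1, mul_apply2, mul_apply3, mul_apply4, mul_apply5, mul_apply6, mul_apply7, add_apply] <;> ring)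
    (by intros; apply ext8 <;> simp only [mul_apply0, mul_apply1, mul_apply2, mul_apply3, mul_apply4, mul_apply5, mul_apply6, mul_apply7, smul_apply] <;> ring)
    (by intros; apply ext8 <;> simp only [mul_apply0, mul_apply1, mul_apply2, mul_apply3, mul_apply4, mul_apply5, mul_apply6, mul_apply7, add_apply] <;> ring)
    (by intros; apply ext8 <;> simp only [mul_apply0, mul_apply1, mul_apply2, mul_apply3, mul_apply4, mul_apply5, mul_apply6, mul_apply7, smul_apply] <;> ring)

end Octonion

/-- A (unital) `𝕆`-bimodule: a real vector space with real-bilinear left and right octonionic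
multiplications, whose associators satisfy `[p,q,x] = [q,x,p] = [x,p,q] = -[q,p,x]`, where
`[a,b,c] = (ab)c - a(bc)`. -/
class OctonionBimodule (M : Type u) [AddCommGroup M] [Module ℝ M] where
  /-- left multiplication, `lmul p x = p x` -/
  lmul : Octonion →ₗ[ℝ] M →ₗ[ℝ] M
  /-- right multiplication, `rmul x p = x p` -/
  rmul : M →ₗ[ℝ] Octonion →ₗ[ℝ] M
  one_lmul : ∀ x : M, lmul 1 x = x
  rmul_one : ∀ x : M, rmul x 1 = x
  assoc_left_mid : ∀ (p q : Octonion) (x : M),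
    lmul (p * q) x - lmul p (lmul q x) = rmul (lmul q x) p - lmul q (rmul x p)
  assoc_mid_right : ∀ (p q : Octonion) (x : M),
    rmul (lmul q x) p - lmul q (rmul x p) = rmul (rmul x p) q - rmul x (p * q)
  assoc_right_left : ∀ (p q : Octonion) (x : M),
    rmul (rmul x p) q - rmul x (p * q) = -(lmul (q * p) x - lmul q (lmul p x))

open OctonionBimodule

/-- The regular bimodule: `𝕆` acting on itself by multiplication. -/
noncomputable instance Octonion.instOctonionBimodule : OctonionBimodule Octonion where
  lmul := Octonion.mulBilin
  rmul := Octonion.mulBilin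
  one_lmul x := Octonion.one_mul' x
  rmul_one x := Octonion.mul_one' x
  assoc_left_mid p q x := Octonion.assoc_cycl p q x
  assoc_mid_right p q x := Octonion.assoc_cycl q x p
  assoc_right_left p q x := (Octonion.assoc_cycl x p q).trans (Octonion.assoc_swap p q x)

section Bimodule

variable {M M' M'' : Type*} [AddCommGroup M] [Module ℝ M] [OctonionBimodule M]
  [AddCommGroup M'] [Module ℝ M'] [OctonionBimodule M']
  [AddCommGroup M''] [Module ℝ M''] [OctonionBimodule M'']

/-- `m ∈ Re M`, i.e. `[p,q,m] = 0` for all octonions `p, q`. -/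
def IsRealVec (m : M) : Prop := ∀ p q : Octonion, lmul (p * q) m - lmul p (lmul q m) = 0

/-- The real part operator `Re m = (5/12) m - (1/12) ∑_{i=1}^7 eᵢ m eᵢ` of an `𝕆`-bimodule. -/
noncomputable def rePart (m : M) : M :=
  (5 / 12 : ℝ) • m -
    (1 / 12 : ℝ) • ∑ i : Fin 7, rmul (lmul (Octonion.e i.succ) m) (Octonion.e i.succ)

/-- The second right associator `B_p(f, x) = f(x) p - f(x p)`. -/
noncomputable def secondAssoc (p : Octonion) (f : M →ₗ[ℝ] M') (x : M) : M' :=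
  rmul (f x) p - f (rmul x p)

/-- Right para-linearity of a real-linear map: `Re B_p(f, x) = 0`. -/
def IsParaLinear (f : M →ₗ[ℝ] M') : Prop :=
  ∀ (p : Octonion) (x : M), rePart (secondAssoc p f x) = 0

/-- `h` is the regular composition of `f` and `g`: the (unique) right para-linear map such that
`Re (h x) = Re (f (g x))` for all `x`. -/
def IsRegularComposition (f : M' →ₗ[ℝ] M'') (g : M →ₗ[ℝ] M') (h : M →ₗ[ℝ] M'') : Prop :=
  IsParaLinear h ∧ ∀ x : M, rePart (h x) = rePart (f (g x))

/-- The slice cone `ℂ(M) = ⋃_J (Re M + J Re M)`, `J` running over the imaginary units. -/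
def sliceCone (M : Type*) [AddCommGroup M] [Module ℝ M] [OctonionBimodule M] : Set M :=
  {z | ∃ J : Octonion, J.IsImagUnit ∧
    ∃ a b : M, IsRealVec a ∧ IsRealVec b ∧ z = a + lmul J b}

/-- The set of all finite sums `∑ z_k p_k` with `z_k ∈ s` and octonions `p_k`. -/
def octonionSpan (s : Set M) : Set M :=
  {x | ∃ (N : ℕ) (z : Fin N → M) (p : Fin N → Octonion),
    (∀ k, z k ∈ s) ∧ x = ∑ k, rmul (z k) (p k)}

end Bimodule

/-- A Hilbert `𝕆`-bimodule: an `𝕆`-bimodule with an `𝕆`-valued inner product, complete for the norm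
`‖x‖ = √⟨x, x⟩`. By polarization, the real inner product of `H` is necessarily `Re ⟨x, y⟩`; the
field `oinner_self` says that `⟨x, x⟩` is real and equal to `‖x‖²`, hence contains positivity. -/
class HilbertOctonionBimodule (H : Type u) [NormedAddCommGroup H] [InnerProductSpace ℝ H]
    [CompleteSpace H] extends OctonionBimodule H where
  /-- the octonionic inner product `⟨x, y⟩` -/
  oinner : H →ₗ[ℝ] H →ₗ[ℝ] Octonion
  oinner_paraLinear : ∀ x : H, IsParaLinear (oinner x)
  oinner_conj : ∀ x y : H, oinner x y = (oinner y x).conj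
  oinner_self : ∀ x : H, oinner x x = (‖x‖ ^ 2 : ℝ) • (1 : Octonion)

open HilbertOctonionBimodule

section Hilbert

variable {H : Type u} [NormedAddCommGroup H] [InnerProductSpace ℝ H] [CompleteSpace H]
  [HilbertOctonionBimodule H]

/-- `S` is the adjoint `T^*` of `T`: for every `y`, the vector `S y` represents (in the sense of the
Riesz theorem) the regular composition of the functional `⟨y, ·⟩` with `T`. -/
def IsOctonionAdjoint (T S : H →L[ℝ] H) : Prop :=
  ∀ y : H, IsRegularComposition (oinner y) (T : H →ₗ[ℝ] H) (oinner (S y))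

/-- Self-adjointness, `T = T^*`. -/
def IsOctonionSelfAdjoint (T : H →L[ℝ] H) : Prop := IsOctonionAdjoint T T

/-- An orthonormal family: `⟨z_i, z_j⟩ = δ_ij`. -/
def IsOctonionOrthonormal {ι : Type*} (z : ι → H) : Prop :=
  (∀ i, oinner (z i) (z i) = 1) ∧ ∀ i j, i ≠ j → oinner (z i) (z j) = 0

/-- A weak associative orthonormal family: orthonormal, and
`B_p(z_i, z_j) = ⟨z_i, z_j⟩ p - ⟨z_i, z_j p⟩ = 0` for all octonions `p`. -/
def IsWeakAssocOrthonormal {ι : Type*} (z : ι → H) : Prop :=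
  IsOctonionOrthonormal z ∧
    ∀ (p : Octonion) (i j : ι), secondAssoc p (oinner (z i)) (z j) = 0

/-- A weak associative orthonormal basis: a maximal weak associative orthonormal family. -/
def IsWeakAssocOrthonormalBasis {ι : Type*} (z : ι → H) : Prop :=
  IsWeakAssocOrthonormal z ∧
    ∀ s : Set H, Set.range z ⊆ s → IsWeakAssocOrthonormal (fun x : s => (x : H)) →
      s = Set.range z

/-- The eigenspace `E_r(T) = {x | T x = x r}` for an octonion `r`. -/
def octonionEigenspace (T : H →L[ℝ] H) (r : Octonion) : Set H := {x | T x = rmul x r}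

/-- `r` is an eigenvalue of `T`: `E_r(T) ≠ 0`. -/
def IsOctonionEigenvalue (T : H →L[ℝ] H) (r : Octonion) : Prop :=
  ∃ x ∈ octonionEigenspace T r, x ≠ 0

/-- `z` is a strong eigenvector of `T` for `r`: a nonzero element of the slice cone
with `T z = z r`. -/
def IsStrongEigenvector (T : H →L[ℝ] H) (r : Octonion) (z : H) : Prop :=
  z ∈ sliceCone H ∧ z ≠ 0 ∧ T z = rmul z r

/-- `r` is a standard strong eigenvalue of `T`: it has a strong eigenvector, and `E_r(T)` is
contained in the closed `𝕆`-span of an orthonormal system of strong eigenvectors for `r`. (If the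
eigenspace lies in the algebraic span, this holds a fortiori; the two notions can only differ when
`E_r(T)` is infinite dimensional, which for a compact `T` and real `r` forces `r = 0`.) -/
def IsStandardStrongEigenvalue (T : H →L[ℝ] H) (r : Octonion) : Prop :=
  (∃ z, IsStrongEigenvector T r z) ∧
    ∃ s : Set H, IsOctonionOrthonormal (fun x : s => (x : H)) ∧
      (∀ z ∈ s, IsStrongEigenvector T r z) ∧
      octonionEigenspace T r ⊆ closure (octonionSpan s)

/-- The slice projection `P_z x = z ⟨z, x⟩`. -/
noncomputable def sliceProj (z : H) : H →ₗ[ℝ] H := (rmul z).comp (oinner z)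

end Hilbert

/-! Over the reals `T` is a compact symmetric operator, so its real eigenspaces are total, and the
hypothesis on eigenvalues puts each of them in the closed octonionic span of an orthonormal system
in the slice cone. The obstacle is that `T` is only para-linear: `T z = r z` does not immediately
give `T (z p) = r (z p)`. This is needed both for octonionic orthogonality of eigenvectors with
different eigenvalues and for the series.

The Rayleigh quotient of `z p` is nevertheless `r` (`inner_map_rmul_self`). Write `z = a + b J` with
`a`, `b` real. Since `T` is octonion-linear on real vectors, `T (z p) - r (z p) = -[J, p, T b]`, and
this is orthogonal to `z p` because associators are skew-adjoint and `[J, p, z p] = 0`. Now descend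
on `|r|` (`IsStrongEigensystem.map_rmul`): if the claim holds for all `t` with `|t| > |r|`, then `z
p` is orthogonal to their eigenspaces. On that complement `T` has norm at most `|r|`, so the
Rayleigh quotient is extremal and `z p` is an eigenvector. Compactness makes the descent well
founded.

On the slice cone, orthogonality passes from `w` to all `w p`
(`oinner_rmul_eq_zero_of_mem_sliceCone`), so the vectors `z_j e_i` form a real Hilbert basis. The
underlying algebra rests on the octonions being spanned by `1` and associators. -/

open Octonion

/-! ### Octonions and their associators -/

namespace Octonion

theorem conj_apply_zero (x : Octonion) : conj x 0 = x 0 := by simp [conj]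

theorem conj_eq (x : Octonion) : conj x = (2 * x 0) • (1 : Octonion) - x := by
  ext i
  by_cases hi : i = 0
  · subst hi; simp [conj, one_apply]; ring
  · simp [conj, one_apply, hi]

theorem add_mul' (x y z : Octonion) : (x + y) * z = x * z + y * z :=
  LinearMap.map_add₂ mulBilin x y z

theorem mul_add' (x y z : Octonion) : x * (y + z) = x * y + x * z := (mulBilin x).map_add y z

theorem sub_mul' (x y z : Octonion) : (x - y) * z = x * z - y * z :=
  LinearMap.map_sub₂ mulBilin x y z

theorem mul_sub' (x y z : Octonion) : x * (y - z) = x * y - x * z := (mulBilin x).map_sub y z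

theorem smul_mul' (r : ℝ) (x y : Octonion) : (r • x) * y = r • (x * y) :=
  LinearMap.map_smul₂ mulBilin r x y

theorem mul_smul' (r : ℝ) (x y : Octonion) : x * (r • y) = r • (x * y) :=
  (mulBilin x).map_smul r y

/-- The associator `[x, y, z]`. -/
noncomputable def assoc (x y z : Octonion) : Octonion := x * y * z - x * (y * z)

/-- Every imaginary basis unit is half of an associator of basis units. -/
theorem assoc_eq_sum_basis (q : Octonion) :
    q = q 0 • (1 : Octonion) + (q 1 / 2) • assoc (e 2) (e 5) (e 6)
      + (q 2 / 2) • assoc (e 1) (e 4) (e 7) + (q 3 / 2) • assoc (e 1) (e 6) (e 4)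
      + (q 4 / 2) • assoc (e 1) (e 3) (e 6) + (q 5 / 2) • assoc (e 1) (e 2) (e 6)
      + (q 6 / 2) • assoc (e 1) (e 4) (e 3) + (q 7 / 2) • assoc (e 1) (e 2) (e 4) := by
  apply ext8 <;>
    simp [assoc, e, one_apply, mul_apply0, mul_apply1, mul_apply2, mul_apply3, mul_apply4,
      mul_apply5, mul_apply6, mul_apply7] <;> ring

/-- The octonions are spanned by `1` and the associators. -/
theorem mem_of_one_mem_of_assoc_mem (S : Submodule ℝ Octonion) (h1 : 1 ∈ S)
    (h : ∀ x y z, assoc x y z ∈ S) (q : Octonion) : q ∈ S := by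
  rw [assoc_eq_sum_basis q]
  exact S.add_mem (S.add_mem (S.add_mem (S.add_mem (S.add_mem (S.add_mem (S.add_mem
    (S.smul_mem _ h1) (S.smul_mem _ (h _ _ _))) (S.smul_mem _ (h _ _ _)))
    (S.smul_mem _ (h _ _ _))) (S.smul_mem _ (h _ _ _))) (S.smul_mem _ (h _ _ _)))
    (S.smul_mem _ (h _ _ _))) (S.smul_mem _ (h _ _ _))

theorem assoc_apply_zero (x y z : Octonion) : assoc x y z 0 = 0 := by
  simp only [assoc, sub_apply, mul_apply0, mul_apply1, mul_apply2, mul_apply3, mul_apply4,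
    mul_apply5, mul_apply6, mul_apply7]
  ring

end Octonion


/-! ### Associators and real vectors in a bimodule -/

section Bimodule

variable {M : Type*} [AddCommGroup M] [Module ℝ M] [OctonionBimodule M]

/-- The associator `[p, q, x]` in a bimodule, in terms of the right multiplication. -/
noncomputable def bimoduleAssoc (p q : Octonion) (x : M) : M :=
  rmul (rmul x p) q - rmul x (p * q)

theorem bimoduleAssoc_eq_left (p q : Octonion) (x : M) :
    bimoduleAssoc p q x = lmul (p * q) x - lmul p (lmul q x) :=
  ((assoc_left_mid p q x).trans (assoc_mid_right p q x)).symm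

theorem bimoduleAssoc_eq_mid (p q : Octonion) (x : M) :
    bimoduleAssoc p q x = rmul (lmul q x) p - lmul q (rmul x p) :=
  (assoc_mid_right p q x).symm

theorem bimoduleAssoc_swap (p q : Octonion) (x : M) :
    bimoduleAssoc p q x = -bimoduleAssoc q p x := by
  rw [bimoduleAssoc_eq_left q p]
  exact assoc_right_left p q x

theorem IsRealVec.bimoduleAssoc_eq_zero {n : M} (hn : IsRealVec n) (p q : Octonion) :
    bimoduleAssoc p q n = 0 := by
  rw [bimoduleAssoc_eq_left]; exact hn p q

theorem IsRealVec.rmul_rmul {n : M} (hn : IsRealVec n) (p q : Octonion) :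
    rmul (rmul n p) q = rmul n (p * q) :=
  sub_eq_zero.1 (hn.bimoduleAssoc_eq_zero p q)

theorem IsRealVec.lmul_lmul {n : M} (hn : IsRealVec n) (p q : Octonion) :
    lmul p (lmul q n) = lmul (p * q) n :=
  (sub_eq_zero.1 (hn p q)).symm

theorem IsRealVec.rmul_lmul {n : M} (hn : IsRealVec n) (p q : Octonion) :
    rmul (lmul q n) p = lmul q (rmul n p) :=
  sub_eq_zero.1 ((bimoduleAssoc_eq_mid p q n).symm.trans (hn.bimoduleAssoc_eq_zero p q))

theorem IsRealVec.bimoduleAssoc_rmul {n : M} (hn : IsRealVec n) (p q r : Octonion) :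
    bimoduleAssoc p q (rmul n r) = rmul n (assoc r p q) := by
  simp only [bimoduleAssoc, hn.rmul_rmul, assoc, map_sub]

theorem IsRealVec.bimoduleAssoc_lmul {n : M} (hn : IsRealVec n) (p q r : Octonion) :
    bimoduleAssoc p q (lmul r n) = lmul (assoc p q r) n := by
  simp only [bimoduleAssoc_eq_left, hn.lmul_lmul, assoc, map_sub, LinearMap.sub_apply]

/-- Reality of `n` allows regrouping, `[p, q, r n] = [q, r, n p]`. Compared with
`bimoduleAssoc_lmul`, this shows that `n` commutes with every associator. -/
theorem IsRealVec.bimoduleAssoc_lmul' {n : M} (hn : IsRealVec n) (p q r : Octonion) :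
    bimoduleAssoc p q (lmul r n) = rmul n (assoc p q r) := by
  have h : bimoduleAssoc p q (lmul r n) = bimoduleAssoc q r (rmul n p) := by
    rw [bimoduleAssoc_eq_mid q r, bimoduleAssoc, hn.rmul_lmul, hn.rmul_lmul, hn.rmul_rmul]
  rw [h, hn.bimoduleAssoc_rmul]

/-- Real vectors commute with all octonions. -/
theorem IsRealVec.lmul_eq_rmul {n : M} (hn : IsRealVec n) (p : Octonion) :
    lmul p n = rmul n p := by
  have h := mem_of_one_mem_of_assoc_mem
    (LinearMap.ker ((lmul (M := M)).flip n - rmul n)) ?_ (fun x y z => ?_) p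
  · exact sub_eq_zero.1 h
  · exact sub_eq_zero.2 ((one_lmul n).trans (rmul_one n).symm)
  · exact sub_eq_zero.2
      ((hn.bimoduleAssoc_lmul x y z).symm.trans (hn.bimoduleAssoc_lmul' x y z))

/-- Left multiplication by an associator, expressed through right multiplications. -/
theorem lmul_assoc (p q r : Octonion) (m : M) :
    (2 : ℝ) • lmul (assoc p q r) m =
      bimoduleAssoc (p * q - q * p) r m
        + bimoduleAssoc q r (rmul m p) - rmul (bimoduleAssoc q r m) p
        - bimoduleAssoc p r (rmul m q) + rmul (bimoduleAssoc p r m) q := by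
  -- The sum of the five-term associator identities for `(p, q, r, m)` and `(q, r, m, p)`; the terms
  -- `[p, q r, m]` and `[p, q, r m]` cancel.
  have key : ∀ p q : Octonion, bimoduleAssoc (p * q) r m + bimoduleAssoc q r (rmul m p)
      = lmul p (bimoduleAssoc q r m) + lmul (assoc p q r) m + lmul q (bimoduleAssoc p r m)
        + rmul (bimoduleAssoc q r m) p := by
    intro p q
    have t1 : bimoduleAssoc (p * q) r m - bimoduleAssoc p (q * r) m
        + bimoduleAssoc p q (lmul r m)
        = lmul p (bimoduleAssoc q r m) + lmul (assoc p q r) m := by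
      simp only [bimoduleAssoc_eq_left, assoc, map_sub, LinearMap.sub_apply]
      abel
    have t2 : bimoduleAssoc p (q * r) m - bimoduleAssoc p q (lmul r m)
        + bimoduleAssoc q r (rmul m p)
        = lmul q (bimoduleAssoc p r m) + rmul (bimoduleAssoc q r m) p := by
      rw [bimoduleAssoc_eq_mid p (q * r), bimoduleAssoc_eq_mid p q,
        bimoduleAssoc_eq_left q r, bimoduleAssoc_eq_mid p r, bimoduleAssoc_eq_left q r]
      simp only [map_sub, LinearMap.sub_apply]
      abel
    linear_combination (norm := module) t1 + t2
  have hs : ∀ p q : Octonion, assoc p q r = - assoc q p r := fun p q => assoc_swap p q r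
  -- Antisymmetrising in `p, q` removes `p [q, r, m] + q [p, r, m]` and doubles `[p, q, r] m`.
  have h1 := key p q
  have h2 := key q p
  rw [hs q p, map_neg, LinearMap.neg_apply] at h2
  have h3 : bimoduleAssoc (p * q - q * p) r m
      = bimoduleAssoc (p * q) r m - bimoduleAssoc (q * p) r m := by
    simp only [bimoduleAssoc, sub_mul', map_sub, LinearMap.sub_apply]
    abel
  rw [h3]
  linear_combination (norm := module) h2 - h1

end Bimodule

/-! ### Conjugation, real parts and imaginary units -/

namespace Octonion

theorem eq_of_forall_mul_apply_zero {x y : Octonion} (h : ∀ p, (x * p) 0 = (y * p) 0) : x = y := by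
  have h' : ∀ i, (x * e i) 0 = (y * e i) 0 := fun i => h (e i)
  have h0 := h' 0
  have h1 := h' 1
  have h2 := h' 2
  have h3 := h' 3
  have h4 := h' 4
  have h5 := h' 5
  have h6 := h' 6
  have h7 := h' 7
  simp [mul_apply0, e] at h0 h1 h2 h3 h4 h5 h6 h7
  exact ext8 h0 h1 h2 h3 h4 h5 h6 h7

theorem mul_conj_e_apply_zero (x : Octonion) (i : Fin 8) : (x * conj (e i)) 0 = x i := by
  fin_cases i <;> simp [mul_apply0, e, conj]

theorem e_mul_conj_e_apply_zero (i j : Fin 8) :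
    (e j * conj (e i)) 0 = if i = j then 1 else 0 := by
  rw [mul_conj_e_apply_zero]; rfl

theorem eq_sum_smul_e (x : Octonion) : x = ∑ i, x i • e i := by
  apply ext8 <;> simp [Fin.sum_univ_eight, e]

theorem conj_mul_apply_zero (x y : Octonion) : (conj x * y) 0 = (x * conj y) 0 := by
  simp [mul_apply0, conj]

theorem conj_zero : conj 0 = 0 := by
  ext i; simp [conj]

theorem conj_add (x y : Octonion) : conj (x + y) = conj x + conj y := by
  ext i; by_cases hi : i = 0 <;> simp [conj, hi, add_comm]

theorem conj_smul (r : ℝ) (x : Octonion) : conj (r • x) = r • conj x := by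
  ext i; by_cases hi : i = 0 <;> simp [conj, hi]

theorem neg_mul' (x y : Octonion) : -x * y = -(x * y) := LinearMap.map_neg₂ mulBilin x y

theorem zero_mul' (x : Octonion) : 0 * x = 0 := LinearMap.map_zero₂ mulBilin x

theorem conj_one : conj 1 = 1 := by
  apply ext8 <;> simp [conj, one_apply]

theorem conj_conj (x : Octonion) : conj (conj x) = x := by
  apply ext8 <;> simp [conj]

theorem conj_mul (x y : Octonion) : conj (x * y) = conj y * conj x := by
  apply ext8 <;> simp [conj, mul_apply0, mul_apply1, mul_apply2, mul_apply3, mul_apply4,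
    mul_apply5, mul_apply6, mul_apply7] <;> ring

theorem conj_mul_mul (x y : Octonion) : conj x * (x * y) = (x * conj x) * y := by
  apply ext8 <;> simp [conj, mul_apply0, mul_apply1, mul_apply2, mul_apply3, mul_apply4,
    mul_apply5, mul_apply6, mul_apply7] <;> ring

theorem assoc_self_left (x y : Octonion) : assoc x x y = 0 := by
  apply ext8 <;> simp [assoc, mul_apply0, mul_apply1, mul_apply2, mul_apply3, mul_apply4,
    mul_apply5, mul_apply6, mul_apply7] <;> ring

theorem assoc_cycl' (x y z : Octonion) : assoc x y z = assoc y z x := assoc_cycl x y z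

theorem assoc_self_outer (x y : Octonion) : assoc x y x = 0 := by
  rw [assoc_cycl', assoc_cycl', assoc_self_left]

theorem assoc_one_mid (x y : Octonion) : assoc x 1 y = 0 := by
  simp [assoc, one_mul', mul_one']

theorem assoc_mul_left (x y : Octonion) : assoc (x * y) x y = 0 := by
  apply ext8 <;> simp [assoc, mul_apply0, mul_apply1, mul_apply2, mul_apply3, mul_apply4,
    mul_apply5, mul_apply6, mul_apply7] <;> ring

theorem rePart_eq (x : Octonion) : rePart x = x 0 • (1 : Octonion) := by
  have h : ∀ p q : Octonion, rmul (M := Octonion) (lmul p q) p = p * q * p := fun _ _ => rfl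
  simp only [rePart, h, Fin.sum_univ_seven]
  apply ext8 <;>
  simp [e, one_apply, mul_apply0, mul_apply1, mul_apply2, mul_apply3, mul_apply4,
    mul_apply5, mul_apply6, mul_apply7] <;> ring

theorem IsImagUnit.conj_eq {J : Octonion} (hJ : J.IsImagUnit) : conj J = -J := by
  rw [Octonion.conj_eq, hJ.1]; simp

theorem IsImagUnit.conj_mul_mul {J : Octonion} (hJ : J.IsImagUnit) (p : Octonion) :
    conj J * (J * p) = p := by
  rw [Octonion.conj_mul_mul, hJ.2, one_mul']

theorem IsImagUnit.mul_mul {J : Octonion} (hJ : J.IsImagUnit) (p : Octonion) :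
    J * (J * p) = -p := by
  have h := hJ.conj_mul_mul p
  rw [hJ.conj_eq, neg_mul'] at h
  rw [← neg_eq_iff_eq_neg, h]

theorem assoc_add_mid (x y z w : Octonion) : assoc x (y + z) w = assoc x y w + assoc x z w := by
  simp only [assoc, mul_add', add_mul']
  abel

theorem assoc_smul_mid (r : ℝ) (x y z : Octonion) : assoc x (r • y) z = r • assoc x y z := by
  simp only [assoc, mul_smul', smul_mul', smul_sub]

/-- If `t ≠ 0`, the relation and its left multiple by `J` can be solved for `K`, giving `K` in the
span of `1` and `J`, where `[J, K, p]` vanishes by alternativity. -/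
theorem IsImagUnit.smul_assoc_eq_zero {J K : Octonion} (hJ : J.IsImagUnit) {t x y w : ℝ}
    (h : t • (J * K) = x • (1 : Octonion) + y • K + w • J) (p : Octonion) :
    t • assoc J K p = 0 := by
  by_cases ht : t = 0
  · rw [ht, zero_smul]
  have h3 := congrArg (mulBilin J) h
  simp only [map_add, map_smul] at h3
  change t • (J * (J * K)) = x • (J * 1) + y • (J * K) + w • (J * J) at h3
  have hJJ : J * J = -1 := by simpa [mul_one'] using hJ.mul_mul 1
  rw [hJ.mul_mul, hJJ, mul_one'] at h3
  have h4 : (t ^ 2 + y ^ 2) • K = (w * t - x * y) • (1 : Octonion) - (x * t + y * w) • J := by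
    linear_combination (norm := module) (-t) • h3 - y • h
  have hpos : t ^ 2 + y ^ 2 ≠ 0 := by positivity
  obtain ⟨α, β, hK⟩ : ∃ α β : ℝ, K = α • (1 : Octonion) + β • J := by
    refine ⟨(t ^ 2 + y ^ 2)⁻¹ * (w * t - x * y), -((t ^ 2 + y ^ 2)⁻¹ * (x * t + y * w)), ?_⟩
    rw [← inv_smul_smul₀ hpos K, h4]
    module
  have h5 : assoc J K p = α • assoc J 1 p + β • assoc J J p := by
    rw [hK, assoc_add_mid, assoc_smul_mid, assoc_smul_mid]
  rw [h5, assoc_one_mid, assoc_self_left, smul_zero, smul_zero, add_zero, smul_zero]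

end Octonion

/-! ### Real parts and the slice cone -/

section Bimodule

variable {M : Type*} [AddCommGroup M] [Module ℝ M] [OctonionBimodule M]

theorem IsRealVec.rePart_rmul {n : M} (hn : IsRealVec n) (p : Octonion) :
    rePart (rmul n p) = p 0 • n := by
  have h : rePart (rmul n p) = rmul n (rePart p) := by
    simp only [rePart, map_sub, map_smul, map_sum, ← hn.rmul_lmul, hn.lmul_eq_rmul, hn.rmul_rmul]
    rfl
  rw [h, rePart_eq, map_smul, rmul_one]

theorem rePart_sub (x y : M) : rePart (x - y) = rePart x - rePart y := by
  simp only [rePart, map_sub, LinearMap.sub_apply, Finset.sum_sub_distrib]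
  module

theorem rePart_add (x y : M) : rePart (x + y) = rePart x + rePart y := by
  simp only [rePart, map_add, LinearMap.add_apply, Finset.sum_add_distrib]
  module

theorem exists_of_mem_sliceCone {z : M} (hz : z ∈ sliceCone M) :
    ∃ (J : Octonion) (a b : M), J.IsImagUnit ∧ IsRealVec a ∧ IsRealVec b ∧ z = a + rmul b J := by
  obtain ⟨J, hJ, a, b, ha, hb, rfl⟩ := hz
  exact ⟨J, a, b, hJ, ha, hb, by rw [hb.lmul_eq_rmul]⟩

theorem rmul_slice {a b : M} (hb : IsRealVec b) (J p : Octonion) :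
    rmul (a + rmul b J) p = rmul a p + rmul b (J * p) := by
  rw [map_add, LinearMap.add_apply, hb.rmul_rmul]

theorem bimoduleAssoc_conj_conj (p q : Octonion) (x : M) :
    bimoduleAssoc (conj q) (conj p) x = - bimoduleAssoc p q x := by
  rw [bimoduleAssoc_swap p q, neg_neg, Octonion.conj_eq, Octonion.conj_eq]
  simp only [bimoduleAssoc, sub_mul', mul_sub', smul_mul', mul_smul', one_mul', mul_one', map_sub,
    map_smul, LinearMap.sub_apply, LinearMap.smul_apply, rmul_one]
  module

theorem bimoduleAssoc_add (p q : Octonion) (x y : M) :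
    bimoduleAssoc p q (x + y) = bimoduleAssoc p q x + bimoduleAssoc p q y := by
  simp only [bimoduleAssoc, map_add, LinearMap.add_apply]
  abel

end Bimodule

/-! ### Inner products on the slice cone, slice projections, para-linear operators -/

section Hilbert

variable {H : Type u} [NormedAddCommGroup H] [InnerProductSpace ℝ H] [CompleteSpace H]
  [HilbertOctonionBimodule H]

local notation "⟪" x ", " y "⟫" => inner ℝ x y

theorem oinner_apply_zero (u v : H) : oinner u v 0 = ⟪u, v⟫ := by
  have h : oinner v u 0 = oinner u v 0 := by rw [oinner_conj u v, conj_apply_zero]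
  have hs : ∀ x : H, oinner x x 0 = ‖x‖ ^ 2 := fun x => by
    rw [oinner_self]; simp [one_apply]
  have h1 := hs (u + v)
  simp only [map_add, LinearMap.add_apply, Octonion.add_apply, hs, h] at h1
  have h2 := norm_add_sq_real u v
  linarith

/-- Para-linearity of `⟨u, ·⟩`, read off in the real coordinate. -/
theorem inner_rmul_right (u v : H) (p : Octonion) : ⟪u, rmul v p⟫ = (oinner u v * p) 0 := by
  have h := oinner_paraLinear u p v
  rw [rePart_eq] at h
  have h0 := congrFun h 0
  rw [Octonion.smul_apply, one_apply] at h0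
  simp only [secondAssoc, Octonion.sub_apply, if_true, mul_one, oinner_apply_zero] at h0
  exact (sub_eq_zero.1 h0).symm

theorem oinner_eq_iff {u v : H} {o : Octonion} :
    oinner u v = o ↔ ∀ p, ⟪u, rmul v p⟫ = (o * p) 0 := by
  simp only [inner_rmul_right]
  exact ⟨fun h p => by rw [h], eq_of_forall_mul_apply_zero⟩

theorem inner_rmul_left (u v : H) (p : Octonion) : ⟪rmul u p, v⟫ = ⟪u, rmul v (conj p)⟫ := by
  rw [real_inner_comm, inner_rmul_right, inner_rmul_right, oinner_conj v u, conj_mul_apply_zero]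

/-- Right multiplication by `p` has real adjoint right multiplication by `conj p`, so `[p, q, ·]`
has adjoint `[conj q, conj p, ·] = -[p, q, ·]`. -/
theorem inner_bimoduleAssoc_left (p q : Octonion) (u v : H) :
    ⟪bimoduleAssoc p q u, v⟫ = -⟪u, bimoduleAssoc p q v⟫ := by
  rw [← inner_neg_right, ← bimoduleAssoc_conj_conj]
  simp only [bimoduleAssoc, inner_sub_left, inner_sub_right, inner_rmul_left, conj_mul]

/-- The commutator of `[q, r, ·]` with right multiplication sees only the imaginary part of `p`, so
it commutes two skew-adjoint operators and is itself skew-adjoint. -/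
theorem inner_commutator_bimoduleAssoc_rmul (p q r : Octonion) (u v : H) :
    ⟪bimoduleAssoc q r (rmul u p) - rmul (bimoduleAssoc q r u) p, v⟫ =
      -⟪u, bimoduleAssoc q r (rmul v p) - rmul (bimoduleAssoc q r v) p⟫ := by
  have h : ∀ x : H, bimoduleAssoc q r (rmul x (conj p)) - rmul (bimoduleAssoc q r x) (conj p)
      = -(bimoduleAssoc q r (rmul x p) - rmul (bimoduleAssoc q r x) p) := by
    intro x
    rw [Octonion.conj_eq]
    simp only [bimoduleAssoc, map_sub, map_smul, LinearMap.sub_apply, LinearMap.smul_apply,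
      rmul_one]
    module
  rw [← inner_neg_right, ← h]
  simp only [inner_sub_left, inner_sub_right, inner_bimoduleAssoc_left, inner_rmul_left]
  ring

/-- It suffices to treat `1` and associators. By `lmul_assoc`, left multiplication by an associator
is built from operators already known to be skew-adjoint. -/
theorem inner_lmul_left (u v : H) (p : Octonion) : ⟪lmul p u, v⟫ = ⟪u, lmul (conj p) v⟫ := by
  let S : Submodule ℝ Octonion :=
    { carrier := {p | ⟪lmul p u, v⟫ = ⟪u, lmul (conj p) v⟫}
      zero_mem' := by simp [conj_zero]
      add_mem' := fun {p q} hp hq => by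
        simp only [Set.mem_ofPred_eq] at hp hq ⊢
        simp only [conj_add, map_add, LinearMap.add_apply, inner_add_left, inner_add_right, hp, hq]
      smul_mem' := fun c p hp => by
        simp only [Set.mem_ofPred_eq] at hp ⊢
        simp only [conj_smul, map_smul, LinearMap.smul_apply, real_inner_smul_left,
          real_inner_smul_right, hp] }
  refine mem_of_one_mem_of_assoc_mem S ?_ (fun x y z => ?_) p
  · change ⟪lmul 1 u, v⟫ = ⟪u, lmul (conj 1) v⟫
    rw [conj_one, one_lmul, one_lmul]
  · change ⟪lmul (assoc x y z) u, v⟫ = ⟪u, lmul (conj (assoc x y z)) v⟫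
    have hc : conj (assoc x y z) = -assoc x y z := by
      rw [Octonion.conj_eq, assoc_apply_zero]; simp
    rw [hc, map_neg, LinearMap.neg_apply, inner_neg_right]
    have h2 : ⟪(2 : ℝ) • lmul (assoc x y z) u, v⟫ = -⟪u, (2 : ℝ) • lmul (assoc x y z) v⟫ := by
      have e1 := inner_bimoduleAssoc_left (x * y - y * x) z u v
      have e2 := inner_commutator_bimoduleAssoc_rmul x y z u v
      have e3 := inner_commutator_bimoduleAssoc_rmul y x z u v
      rw [lmul_assoc, lmul_assoc]
      simp only [inner_add_left, inner_sub_left, inner_add_right, inner_sub_right] at e2 e3 ⊢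
      linarith
    rw [real_inner_smul_left, real_inner_smul_right] at h2
    linarith

/-- On real vectors the octonionic inner product is real. -/
theorem IsRealVec.inner_rmul {a b : H} (ha : IsRealVec a) (hb : IsRealVec b) (p : Octonion) :
    ⟪a, rmul b p⟫ = ⟪a, b⟫ * p 0 := by
  let S : Submodule ℝ Octonion :=
    { carrier := {p | ⟪a, rmul b p⟫ = ⟪a, b⟫ * p 0}
      zero_mem' := by simp
      add_mem' := fun {p q} hp hq => by
        simp only [Set.mem_ofPred_eq] at hp hq ⊢
        rw [map_add, inner_add_right, hp, hq, Octonion.add_apply, mul_add]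
      smul_mem' := fun c p hp => by
        simp only [Set.mem_ofPred_eq] at hp ⊢
        rw [map_smul, real_inner_smul_right, hp, Octonion.smul_apply, mul_left_comm] }
  refine mem_of_one_mem_of_assoc_mem S ?_ (fun x y z => ?_) p
  · change ⟪a, rmul b 1⟫ = ⟪a, b⟫ * (1 : Octonion) 0
    rw [rmul_one, one_apply, if_pos rfl, mul_one]
  · change ⟪a, rmul b (assoc x y z)⟫ = ⟪a, b⟫ * assoc x y z 0
    -- `b [x, y, z] = [y, z, b x]`; moving the associator onto the real vector `a` kills it.
    rw [assoc_apply_zero, mul_zero, ← hb.bimoduleAssoc_rmul, ← neg_inj,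
      ← inner_bimoduleAssoc_left, ha.bimoduleAssoc_eq_zero, inner_zero_left, neg_zero]

theorem IsRealVec.oinner_rmul_rmul {a b : H} (ha : IsRealVec a) (hb : IsRealVec b)
    (p q : Octonion) : oinner (rmul a p) (rmul b q) = ⟪a, b⟫ • (conj p * q) := by
  rw [oinner_eq_iff]
  intro r
  rw [inner_rmul_left, hb.rmul_rmul, hb.rmul_rmul, ha.inner_rmul hb, smul_mul',
    Octonion.smul_apply]
  congr 1
  simp [conj, mul_apply0, mul_apply1, mul_apply2, mul_apply3, mul_apply4,
    mul_apply5, mul_apply6, mul_apply7]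
  ring

/-- The inner product of two vectors of the slice cone. -/
theorem oinner_slice {a b c d : H} (ha : IsRealVec a) (hb : IsRealVec b) (hc : IsRealVec c)
    (hd : IsRealVec d) (J K p : Octonion) :
    oinner (a + rmul b J) (rmul (c + rmul d K) p) =
      ⟪a, c⟫ • p + ⟪a, d⟫ • (K * p) + ⟪b, c⟫ • (conj J * p) + ⟪b, d⟫ • (conj J * (K * p)) := by
  rw [rmul_slice hd]
  have h : oinner (a + rmul b J) = oinner (rmul a 1 + rmul b J) := by rw [rmul_one]
  rw [h]
  simp only [map_add, LinearMap.add_apply, ha.oinner_rmul_rmul hc, ha.oinner_rmul_rmul hd,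
    hb.oinner_rmul_rmul hc, hb.oinner_rmul_rmul hd, conj_one, one_mul']
  abel

theorem oinner_rmul_self_of_mem_sliceCone {z : H} (hz : z ∈ sliceCone H) (p : Octonion) :
    oinner z (rmul z p) = ‖z‖ ^ 2 • p := by
  obtain ⟨J, a, b, hJ, ha, hb, rfl⟩ := exists_of_mem_sliceCone hz
  have h : ∀ p, oinner (a + rmul b J) (rmul (a + rmul b J) p) = (⟪a, a⟫ + ⟪b, b⟫) • p := by
    intro p
    rw [oinner_slice ha hb ha hb, hJ.conj_mul_mul, hJ.conj_eq, Octonion.neg_mul',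
      real_inner_comm a b]
    module
  rw [h]
  have h1 := h 1
  rw [rmul_one, oinner_self] at h1
  have h2 := congrFun h1 0
  rw [Octonion.smul_apply, Octonion.smul_apply, one_apply, if_pos rfl, mul_one, mul_one] at h2
  rw [h2]

/-- For `z = a + b J` and `w = c + d K`, the difference of `⟨z, w p⟩` and `⟨z, w⟩ p` is a multiple
of `⟪b, d⟫ [J, K, p]`, and `⟨z, w⟩ = 0` is exactly the relation required by `smul_assoc_eq_zero`. -/
theorem oinner_rmul_eq_zero_of_mem_sliceCone {z w : H} (hz : z ∈ sliceCone H)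
    (hw : w ∈ sliceCone H) (h : oinner z w = 0) (p : Octonion) : oinner z (rmul w p) = 0 := by
  obtain ⟨J, a, b, hJ, ha, hb, rfl⟩ := exists_of_mem_sliceCone hz
  obtain ⟨K, c, d, -, hc, hd, rfl⟩ := exists_of_mem_sliceCone hw
  have h1 := oinner_slice ha hb hc hd J K 1
  rw [rmul_one, h, mul_one', mul_one', hJ.conj_eq, Octonion.neg_mul'] at h1
  rw [oinner_slice ha hb hc hd, hJ.conj_eq, Octonion.neg_mul', Octonion.neg_mul']
  have key := hJ.smul_assoc_eq_zero (K := K) (t := ⟪b, d⟫) (x := ⟪a, c⟫) (y := ⟪a, d⟫)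
    (w := -⟪b, c⟫) (by linear_combination (norm := module) h1) p
  have h6 := congrArg (mulBilin.flip p) h1
  simp only [map_add, map_smul, map_neg, map_zero] at h6
  change 0 = ⟪a, c⟫ • (1 * p) + ⟪a, d⟫ • (K * p) + ⟪b, c⟫ • -(J * p) + ⟪b, d⟫ • -(J * K * p)
    at h6
  rw [one_mul'] at h6
  rw [assoc] at key
  linear_combination (norm := module) key - h6

theorem inner_rmul_rmul_of_mem_sliceCone {z : H} (hz : z ∈ sliceCone H) (p q : Octonion) :
    ⟪rmul z p, rmul z q⟫ = ‖z‖ ^ 2 * (q * conj p) 0 := by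
  have h := inner_rmul_right z (rmul z q) (conj p)
  rw [oinner_rmul_self_of_mem_sliceCone hz, smul_mul', Octonion.smul_apply] at h
  rw [inner_rmul_left, h]

theorem inner_rmul_rmul_eq_zero_of_mem_sliceCone {z w : H} (hz : z ∈ sliceCone H)
    (hw : w ∈ sliceCone H) (h : oinner z w = 0) (p q : Octonion) :
    ⟪rmul z p, rmul w q⟫ = 0 := by
  rw [inner_rmul_left, inner_rmul_right, oinner_rmul_eq_zero_of_mem_sliceCone hz hw h, zero_mul',
    Octonion.zero_apply]

theorem oinner_apply (u v : H) (i : Fin 8) : oinner u v i = ⟪rmul u (e i), v⟫ := by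
  rw [inner_rmul_left, inner_rmul_right, mul_conj_e_apply_zero]

theorem oinner_eq_zero_iff {u v : H} : oinner u v = 0 ↔ ∀ p, ⟪rmul u p, v⟫ = 0 := by
  constructor
  · intro h p
    rw [inner_rmul_left, inner_rmul_right, h, zero_mul', Octonion.zero_apply]
  · intro h
    ext i
    rw [oinner_apply, h, Octonion.zero_apply]

theorem sliceProj_eq_sum (z x : H) : sliceProj z x = ∑ i, ⟪rmul z (e i), x⟫ • rmul z (e i) := by
  change rmul z (oinner z x) = _
  conv_lhs => rw [eq_sum_smul_e (oinner z x)]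
  simp only [map_sum, map_smul, oinner_apply]

theorem sliceProj_sliceProj {z : H} (hz : z ∈ sliceCone H) (h1 : ‖z‖ = 1) (x : H) :
    sliceProj z (sliceProj z x) = sliceProj z x := by
  change rmul z (oinner z (rmul z (oinner z x))) = rmul z (oinner z x)
  rw [oinner_rmul_self_of_mem_sliceCone hz, h1]
  simp

/-- For `z = a + b J`, the real part of `z q` is `Re q` times `a` plus `Re (J q)` times `b`. Both
coefficients agree for `⟨z, x⟩ p` and `⟨z, x p⟩`, the second because `[p, J, z] = 0`. -/
theorem isParaLinear_sliceProj {z : H} (hz : z ∈ sliceCone H) : IsParaLinear (sliceProj z) := by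
  intro p x
  obtain ⟨J, a, b, hJ, ha, hb, rfl⟩ := exists_of_mem_sliceCone hz
  set z := a + rmul b J with hz_def
  change rePart (rmul (rmul z (oinner z x)) p - rmul z (oinner z (rmul x p))) = 0
  set q := oinner z x with hq
  set q' := oinner z (rmul x p) with hq'
  have h1 : (q * p) 0 = q' 0 := by
    rw [hq', oinner_apply_zero, inner_rmul_right]
  have h2 : (J * q * p) 0 = (J * q') 0 := by
    have e1 : (J * q * p) 0 = (q * (p * J)) 0 := by simp only [mul_apply0, mul_apply1,
      mul_apply2, mul_apply3, mul_apply4, mul_apply5, mul_apply6, mul_apply7]; ring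
    have e2 : (J * q') 0 = (q' * J) 0 := by simp only [mul_apply0]; ring
    have e3 : bimoduleAssoc p J z = 0 := by
      rw [hz_def, bimoduleAssoc_add, ha.bimoduleAssoc_eq_zero, hb.bimoduleAssoc_rmul,
        assoc_self_outer]
      simp
    have e4 := inner_bimoduleAssoc_left p J z x
    rw [e3, inner_zero_left, bimoduleAssoc, inner_sub_right, inner_rmul_right,
      inner_rmul_right z x] at e4
    rw [e1, e2]
    linarith
  rw [hz_def, rmul_slice hb, rmul_slice hb, map_add, LinearMap.add_apply, ha.rmul_rmul,
    hb.rmul_rmul, rePart_sub, rePart_add, rePart_add, ha.rePart_rmul, ha.rePart_rmul,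
    hb.rePart_rmul, hb.rePart_rmul, h1, h2, sub_self]

/-- Each `e_i m e_i` pairs with `a` as `-m` does, and `5/12 + 7/12 = 1`. Hence para-linearity can be
tested against real vectors. -/
theorem IsRealVec.inner_rePart {a : H} (ha : IsRealVec a) (m : H) : ⟪rePart m, a⟫ = ⟪m, a⟫ := by
  have h : ∀ i : Fin 7, ⟪rmul (lmul (e i.succ) m) (e i.succ), a⟫ = -⟪m, a⟫ := by
    intro i
    have hi : conj (e i.succ) * conj (e i.succ) = -1 := by
      apply ext8 <;> fin_cases i <;> simp [mul_apply0, mul_apply1, mul_apply2, mul_apply3,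
        mul_apply4, mul_apply5, mul_apply6, mul_apply7, e, conj, one_apply]
    rw [inner_rmul_left, inner_lmul_left, ← ha.rmul_lmul, ha.lmul_eq_rmul, ha.rmul_rmul, hi,
      map_neg, rmul_one, inner_neg_right]
  rw [rePart, inner_sub_left, real_inner_smul_left, real_inner_smul_left, sum_inner]
  simp only [h, Finset.sum_const, Finset.card_univ, Fintype.card_fin]
  simp
  ring

variable {T : H →L[ℝ] H}

theorem IsOctonionSelfAdjoint.isSymmetric (hself : IsOctonionSelfAdjoint T) :
    (T : H →ₗ[ℝ] H).IsSymmetric := by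
  intro x y
  have h := (hself x).2 y
  rw [rePart_eq, rePart_eq] at h
  have h0 := congrFun h 0
  rw [Octonion.smul_apply, Octonion.smul_apply, one_apply, if_pos rfl, mul_one, mul_one,
    oinner_apply_zero, oinner_apply_zero] at h0
  exact h0

theorem IsParaLinear.inner_map_rmul (hpara : IsParaLinear (T : H →ₗ[ℝ] H)) {a : H}
    (ha : IsRealVec a) (x : H) (p : Octonion) : ⟪T (rmul x p), a⟫ = ⟪rmul (T x) p, a⟫ := by
  have h := congrArg (fun y => ⟪y, a⟫) (hpara p x)
  simp only [ha.inner_rePart, inner_zero_left] at h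
  rw [secondAssoc, inner_sub_left, sub_eq_zero] at h
  exact h.symm

/-- A self-adjoint para-linear operator is `𝕆`-linear on real vectors. -/
theorem map_rmul_of_isRealVec (hpara : IsParaLinear (T : H →ₗ[ℝ] H))
    (hself : IsOctonionSelfAdjoint T) {a : H} (ha : IsRealVec a) (p : Octonion) :
    T (rmul a p) = rmul (T a) p := by
  refine ext_inner_left ℝ fun x => ?_
  have h1 := hself.isSymmetric x (rmul a p)
  have h2 := hself.isSymmetric (rmul x (conj p)) a
  -- The only use of para-linearity: `T (x (conj p))` and `(T x) (conj p)` have the same product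
  -- with `a`; the rest moves `T` and `p` across the inner product.
  have h3 := hpara.inner_map_rmul ha x (conj p)
  have h4 := inner_rmul_left (T x) a (conj p)
  have h5 := inner_rmul_left x (T a) (conj p)
  simp only [ContinuousLinearMap.coe_coe, conj_conj] at h1 h2 h3 h4 h5
  rw [← h1, ← h4, ← h3, h2, h5]

theorem inner_map_rmul_self (hpara : IsParaLinear (T : H →ₗ[ℝ] H))
    (hself : IsOctonionSelfAdjoint T) {z : H} (hz : z ∈ sliceCone H) {r : ℝ} (hTz : T z = r • z)
    (p : Octonion) : ⟪T (rmul z p), rmul z p⟫ = r * ‖rmul z p‖ ^ 2 := by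
  obtain ⟨J, a, b, hJ, ha, hb, rfl⟩ := exists_of_mem_sliceCone hz
  set z := a + rmul b J with hz_def
  have h1 : T (rmul z p) = r • rmul z p - bimoduleAssoc J p (T b) := by
    have h2 : r • rmul z p = rmul (T a) p + rmul (rmul (T b) J) p := by
      rw [← LinearMap.smul_apply, ← map_smul, ← hTz, hz_def, map_add,
        map_rmul_of_isRealVec hpara hself hb, map_add, LinearMap.add_apply]
    rw [h2, hz_def, rmul_slice hb, map_add, map_rmul_of_isRealVec hpara hself ha,
      map_rmul_of_isRealVec hpara hself hb, bimoduleAssoc]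
    abel
  have h3 : bimoduleAssoc J p (rmul z p) = 0 := by
    rw [hz_def, rmul_slice hb, bimoduleAssoc_add, ha.bimoduleAssoc_rmul, hb.bimoduleAssoc_rmul,
      assoc_self_outer, assoc_mul_left]
    simp
  rw [h1, inner_sub_left, inner_bimoduleAssoc_left, h3, real_inner_smul_left,
    real_inner_self_eq_norm_sq, inner_zero_right]
  ring

end Hilbert

/-! ### Compact symmetric operators on real Hilbert spaces -/

section RealHilbert

variable {E : Type*} [NormedAddCommGroup E] [InnerProductSpace ℝ E]
  {T : E →L[ℝ] E}

/-- A compact symmetric operator is bounded by `c` on the orthogonal complement of the eigenspaces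
for the eigenvalues of absolute value greater than `c`. -/
theorem IsCompactOperator.norm_map_le_of_orthogonal_eigenspaces [CompleteSpace E]
    (hT : IsCompactOperator T)
    (hT' : (T : E →ₗ[ℝ] E).IsSymmetric) {c : ℝ} (hc : 0 ≤ c) {x : E}
    (hx : ∀ μ : ℝ, c < |μ| → ∀ y, T y = μ • y → inner ℝ y x = 0) : ‖T x‖ ≤ c * ‖x‖ := by
  let W : Submodule ℝ E :=
    (⨆ μ : {μ : ℝ // c < |μ|}, Module.End.eigenspace (T : Module.End ℝ E) (μ : ℝ))ᗮ
  have hW : ∀ v : E, v ∈ W ↔ ∀ μ : ℝ, c < |μ| → ∀ y, T y = μ • y → inner ℝ y v = 0 := by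
    intro v
    simp only [W, ← Submodule.iInf_orthogonal, Submodule.mem_iInf, Submodule.mem_orthogonal,
      Module.End.mem_eigenspace_iff, Subtype.forall, ContinuousLinearMap.coe_coe]
  have hinv : ∀ v ∈ W, T v ∈ W := by
    intro v hv
    rw [hW] at hv ⊢
    intro μ hμ y hy
    have h := hT' y v
    simp only [ContinuousLinearMap.coe_coe] at h
    rw [← h, hy, real_inner_smul_left, hv μ hμ y hy, mul_zero]
  let S : W →L[ℝ] W := T.restrict hinv
  have hS_compact : IsCompactOperator S := hT.restrict' hinv
  have hS_symm : (S : W →ₗ[ℝ] W).IsSymmetric := hT'.restrict_invariant hinv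
  -- The norm of a self-adjoint operator is its spectral radius, and nonzero spectrum of a compact
  -- one consists of eigenvalues. An eigenvector in `W` with `|μ| > c` would be orthogonal to
  -- itself.
  have hnorm : ‖S‖ ≤ c := by
    have h := S.spectralRadius_eq_nnnorm hS_symm.isSelfAdjoint
    have h2 : spectralRadius ℝ S ≤ (c.toNNReal : ENNReal) := by
      refine iSup₂_le fun μ hμ => ?_
      by_contra! hlt
      have hμc : c < |μ| := by
        rw [ENNReal.coe_lt_coe, Real.toNNReal_lt_iff_lt_coe hc] at hlt
        simpa using hlt
      have hμ0 : μ ≠ 0 := by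
        rintro rfl; simp at hμc; linarith
      obtain ⟨y, hy⟩ := ((hS_compact.hasEigenvalue_iff_mem_spectrum hμ0).2 hμ).exists_hasEigenvector
      have hTy : T (y : E) = μ • (y : E) := congrArg Subtype.val hy.apply_eq_smul
      have := (hW y).1 y.2 μ hμc y hTy
      rw [inner_self_eq_zero] at this
      exact hy.2 (Subtype.ext this)
    rw [h, ENNReal.coe_le_coe] at h2
    have h3 : (‖S‖₊ : ℝ) ≤ c.toNNReal := by exact_mod_cast h2
    rwa [Real.coe_toNNReal c hc] at h3
  exact (S.le_opNorm ⟨x, (hW x).2 hx⟩).trans (mul_le_mul_of_nonneg_right hnorm (norm_nonneg x))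

/-- The eigenvalues along an orthonormal family of eigenvectors of a compact operator tend to
zero. -/
theorem IsCompactOperator.tendsto_eigenvalues {ι : Type*} (hT : IsCompactOperator T) {v : ι → E}
    (hv : Orthonormal ℝ v) {lam : ι → ℝ} (hlam : ∀ i, T (v i) = lam i • v i) :
    Tendsto lam cofinite (𝓝 0) := by
  rw [Metric.tendsto_nhds]
  intro ε hε
  rw [eventually_cofinite]
  by_contra hinf
  have hinf : {i | ¬dist (lam i) 0 < ε}.Infinite := hinf
  let f := hinf.natEmbedding
  have hf : ∀ n, ε ≤ |lam (f n)| := fun n => by simpa using (f n).2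
  obtain ⟨K, hK, hKT⟩ := IsCompactOperator.image_closedBall_subset_compact (𝕜₁ := ℝ)
    (f := (T : E →ₗ[ℝ] E)) hT 1
  have hmem : ∀ n, T (v (f n)) ∈ K := fun n =>
    hKT ⟨v (f n), by simp [hv.1], rfl⟩
  obtain ⟨a, -, φ, hφ, ha⟩ := hK.tendsto_subseq hmem
  obtain ⟨N, hN⟩ := Metric.cauchySeq_iff'.1 ha.cauchySeq ε hε
  have h := hN (N + 1) (Nat.le_succ N)
  have hne : ((f (φ (N + 1))) : ι) ≠ f (φ N) := fun h =>
    (hφ (Nat.lt_succ_self N)).ne' (f.injective (Subtype.ext h))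
  -- By Pythagoras the images stay at distance at least `ε`, so no subsequence is Cauchy.
  have hsq : ‖T (v (f (φ (N + 1)))) - T (v (f (φ N)))‖ ^ 2
      = lam (f (φ (N + 1))) ^ 2 + lam (f (φ N)) ^ 2 := by
    rw [hlam, hlam, norm_sub_sq_real, real_inner_smul_left, real_inner_smul_right, hv.2 hne,
      norm_smul, norm_smul, hv.1, hv.1]
    simp
  rw [dist_eq_norm] at h
  have h1 : ‖T (v (f (φ (N + 1)))) - T (v (f (φ N)))‖ ^ 2 < ε ^ 2 :=
    pow_lt_pow_left₀ h (norm_nonneg _) two_ne_zero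
  have h2 : ε ^ 2 ≤ lam (f (φ (N + 1))) ^ 2 := by
    rw [← sq_abs (lam _)]
    exact pow_le_pow_left₀ hε.le (hf _) 2
  nlinarith [sq_nonneg (lam (f (φ N)))]

/-- The equality case of Cauchy-Schwarz: expanding `‖T x - r x‖ ^ 2` gives at most `0`. -/
theorem eq_smul_of_norm_le_of_inner_eq {x : E} {r : ℝ} (h1 : ‖T x‖ ≤ |r| * ‖x‖)
    (h2 : inner ℝ (T x) x = r * ‖x‖ ^ 2) : T x = r • x := by
  have h3 : ‖T x‖ ^ 2 ≤ r ^ 2 * ‖x‖ ^ 2 := by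
    rw [← sq_abs r, ← mul_pow]
    exact pow_le_pow_left₀ (norm_nonneg _) h1 2
  have h4 : ‖T x - r • x‖ ^ 2 ≤ 0 := by
    rw [norm_sub_sq_real, real_inner_smul_right, h2, norm_smul, mul_pow, Real.norm_eq_abs, sq_abs]
    linarith
  have h5 : ‖T x - r • x‖ = 0 := by
    nlinarith [norm_nonneg (T x - r • x)]
  exact sub_eq_zero.1 (norm_eq_zero.1 h5)

theorem inner_eq_zero_of_eigenvectors (hT' : (T : E →ₗ[ℝ] E).IsSymmetric) {x y : E} {r t : ℝ}
    (hx : T x = r • x) (hy : T y = t • y) (hrt : r ≠ t) : inner ℝ x y = 0 := by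
  have h := hT' x y
  simp only [ContinuousLinearMap.coe_coe, hx, hy, real_inner_smul_left, real_inner_smul_right] at h
  have h2 : (r - t) * inner ℝ x y = 0 := by linarith
  exact (mul_eq_zero.1 h2).resolve_left (sub_ne_zero.2 hrt)

end RealHilbert

/-! ### Strong eigensystems and the spectral expansion -/

section Hilbert

variable {H : Type u} [NormedAddCommGroup H] [InnerProductSpace ℝ H] [CompleteSpace H]
  [HilbertOctonionBimodule H]

local notation "⟪" x ", " y "⟫" => inner ℝ x y

theorem inner_eq_zero_of_mem_closure_octonionSpan {s : Set H} {x y : H}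
    (hs : ∀ z ∈ s, ∀ p, ⟪rmul z p, x⟫ = 0) (hy : y ∈ closure (octonionSpan s)) :
    ⟪y, x⟫ = 0 := by
  have hcl : IsClosed {y : H | ⟪y, x⟫ = 0} :=
    isClosed_eq (continuous_id.inner continuous_const) continuous_const
  refine closure_minimal ?_ hcl hy
  rintro _ ⟨N, z, p, hz, rfl⟩
  change ⟪_, x⟫ = 0
  rw [sum_inner]
  exact Finset.sum_eq_zero fun k _ => hs _ (hz k) _

theorem norm_eq_one_of_oinner_self {z : H} (hz : oinner z z = 1) : ‖z‖ = 1 := by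
  have h := oinner_apply_zero z z
  rw [hz, one_apply, if_pos rfl, real_inner_self_eq_norm_sq] at h
  exact (pow_eq_one_iff_of_nonneg (norm_nonneg z) two_ne_zero).1 h.symm

/-- A choice, for every real number `r`, of an orthonormal system of strong eigenvectors of `T`
for `r` with octonionic span dense in a set containing the eigenspace for `r`. -/
structure IsStrongEigensystem (T : H →L[ℝ] H) (s : ℝ → Set H) : Prop where
  orthonormal : ∀ r, IsOctonionOrthonormal (fun x : s r => (x : H))
  mem_sliceCone : ∀ {r z}, z ∈ s r → z ∈ sliceCone H
  map_eq : ∀ {r z}, z ∈ s r → T z = r • z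
  mem_closure : ∀ {r y}, T y = r • y → y ∈ closure (octonionSpan (s r))

namespace IsStrongEigensystem

variable {T : H →L[ℝ] H} {s : ℝ → Set H}

theorem norm_eq_one (hs : IsStrongEigensystem T s) {r : ℝ} {z : H} (hz : z ∈ s r) : ‖z‖ = 1 :=
  norm_eq_one_of_oinner_self ((hs.orthonormal r).1 ⟨z, hz⟩)

/-- The descent step: `z p` is orthogonal to all eigenspaces beyond `|r|`, so `T` is bounded by
`|r|` there while the Rayleigh quotient equals `r`. -/
theorem map_rmul_of_forall_abs_lt (hs : IsStrongEigensystem T s)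
    (hpara : IsParaLinear (T : H →ₗ[ℝ] H)) (hcompact : IsCompactOperator T)
    (hself : IsOctonionSelfAdjoint T) {r : ℝ}
    (hr : ∀ t, |r| < |t| → ∀ w ∈ s t, ∀ p, T (rmul w p) = t • rmul w p) {z : H} (hz : z ∈ s r)
    (p : Octonion) : T (rmul z p) = r • rmul z p := by
  have hzc := hs.mem_sliceCone hz
  have hTz := hs.map_eq hz
  refine eq_smul_of_norm_le_of_inner_eq ?_ (inner_map_rmul_self hpara hself hzc hTz p)
  refine hcompact.norm_map_le_of_orthogonal_eigenspaces hself.isSymmetric (abs_nonneg r) ?_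
  intro t ht y hy
  refine inner_eq_zero_of_mem_closure_octonionSpan (fun w hw q => ?_) (hs.mem_closure hy)
  refine inner_rmul_rmul_eq_zero_of_mem_sliceCone (hs.mem_sliceCone hw) hzc
    (oinner_eq_zero_iff.2 fun q => ?_) _ _
  exact inner_eq_zero_of_eigenvectors hself.isSymmetric (hr t ht w hw q) hTz
    (by rintro rfl; exact lt_irrefl _ ht)

/-- On the octonionic multiples of its strong eigenvectors, `T` acts as multiplication by the
eigenvalue. -/
theorem map_rmul (hs : IsStrongEigensystem T s)
    (hpara : IsParaLinear (T : H →ₗ[ℝ] H)) (hcompact : IsCompactOperator T)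
    (hself : IsOctonionSelfAdjoint T) {r : ℝ} {z : H} (hz : z ∈ s r) (p : Octonion) :
    T (rmul z p) = r • rmul z p := by
  have hne : ∀ r : ℝ, r ≠ 0 → ∀ w ∈ s r, ∀ p, T (rmul w p) = r • rmul w p := by
    by_contra! hbad
    obtain ⟨r₀, hr₀, hB₀⟩ := hbad
    let B : Set ℝ := {r | ∃ w ∈ s r, ∃ p, T (rmul w p) ≠ r • rmul w p}
    choose! v hv hv' using fun (r : ℝ) (hr : r ∈ B) => hr
    have hortho : Orthonormal ℝ (fun r : B => v r) :=
      ⟨fun r => hs.norm_eq_one (hv r r.2), fun r t hrt =>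
        inner_eq_zero_of_eigenvectors hself.isSymmetric (hs.map_eq (hv r r.2))
          (hs.map_eq (hv t t.2)) (fun h => hrt (Subtype.ext h))⟩
    have htend := hcompact.tendsto_eigenvalues hortho (lam := fun r : B => (r : ℝ))
      (fun r => hs.map_eq (hv r r.2))
    -- Bad eigenvalues can accumulate only at `0`, so one has maximal absolute value; the descent
    -- step applies to it and gives a contradiction.
    have hfin : {r : B | |r₀| ≤ |(r : ℝ)|}.Finite := by
      have h := (Metric.tendsto_nhds.1 htend) |r₀| (abs_pos.2 hr₀)
      rw [eventually_cofinite] at h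
      simpa using h
    obtain ⟨r₁, hr₁, hmax⟩ := Set.exists_max_image _ (fun r : B => |(r : ℝ)|) hfin
      ⟨⟨r₀, hB₀⟩, le_refl |r₀|⟩
    obtain ⟨w, hw, q, hq⟩ := r₁.2
    refine hq (hs.map_rmul_of_forall_abs_lt hpara hcompact hself (fun t ht y hy p => ?_) hw q)
    by_contra hcon
    exact absurd (hmax ⟨t, y, hy, p, hcon⟩ (le_trans hr₁ ht.le)) (not_le.2 ht)
  -- This also covers `r = 0`, since any `t` with `|t| > |r|` is nonzero.
  refine hs.map_rmul_of_forall_abs_lt hpara hcompact hself (fun t ht => hne t ?_) hz p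
  exact abs_pos.1 (lt_of_le_of_lt (abs_nonneg r) ht)

theorem oinner_eq_zero (hs : IsStrongEigensystem T s)
    (hpara : IsParaLinear (T : H →ₗ[ℝ] H)) (hcompact : IsCompactOperator T)
    (hself : IsOctonionSelfAdjoint T) {r t : ℝ} {z w : H} (hz : z ∈ s r) (hw : w ∈ s t)
    (hzw : z ≠ w) : oinner z w = 0 := by
  by_cases hrt : r = t
  · subst hrt
    exact (hs.orthonormal r).2 ⟨z, hz⟩ ⟨w, hw⟩ fun h => hzw (congrArg Subtype.val h)
  · exact oinner_eq_zero_iff.2 fun p => inner_eq_zero_of_eigenvectors hself.isSymmetric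
      (hs.map_rmul hpara hcompact hself hz p) (hs.map_eq hw) hrt

/-- The strong eigenvectors of the system are total. -/
theorem eq_zero_of_forall_oinner_eq_zero (hs : IsStrongEigensystem T s)
    (hcompact : IsCompactOperator T) (hself : IsOctonionSelfAdjoint T) {x : H}
    (hx : ∀ r, ∀ z ∈ s r, oinner z x = 0) : x = 0 := by
  have h : x ∈ (⨆ μ, Module.End.eigenspace (T : Module.End ℝ H) μ)ᗮ := by
    simp only [← Submodule.iInf_orthogonal, Submodule.mem_iInf, Submodule.mem_orthogonal,
      Module.End.mem_eigenspace_iff, ContinuousLinearMap.coe_coe]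
    intro r y hy
    exact inner_eq_zero_of_mem_closure_octonionSpan
      (fun z hz => oinner_eq_zero_iff.1 (hx r z hz)) (hs.mem_closure hy)
  rwa [ContinuousLinearMap.orthogonalComplement_iSup_eigenspaces_eq_bot hcompact hself.isSymmetric,
    Submodule.mem_bot] at h

end IsStrongEigensystem

theorem rmul_smul_one (x : H) (r : ℝ) : rmul x (r • (1 : Octonion)) = r • x := by
  rw [map_smul, rmul_one]

theorem exists_isStrongEigensystem {T : H →L[ℝ] H}
    (heig : ∀ r : ℝ, IsOctonionEigenvalue T (r • (1 : Octonion)) →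
      IsStandardStrongEigenvalue T (r • (1 : Octonion))) : ∃ s, IsStrongEigensystem T s := by
  have h : ∀ r : ℝ, ∃ s : Set H, IsOctonionOrthonormal (fun x : s => (x : H)) ∧
      (∀ z ∈ s, IsStrongEigenvector T (r • (1 : Octonion)) z) ∧
      octonionEigenspace T (r • (1 : Octonion)) ⊆ closure (octonionSpan s) := by
    intro r
    by_cases hr : IsOctonionEigenvalue T (r • (1 : Octonion))
    · exact (heig r hr).2
    -- For `r` not an eigenvalue the eigenspace is `0`, which is the empty sum.
    · refine ⟨∅, ⟨fun i => i.2.elim, fun i => i.2.elim⟩, fun z hz => hz.elim, fun y hy => ?_⟩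
      have hy0 : y = 0 := by
        by_contra hne
        exact hr ⟨y, hy, hne⟩
      exact subset_closure ⟨0, Fin.elim0, Fin.elim0, fun k => k.elim0, by simp [hy0]⟩
  choose s h1 h2 h3 using h
  refine ⟨s, h1, fun hz => (h2 _ _ hz).1, fun hz => ?_, fun {r y} hy => h3 r ?_⟩
  · rw [(h2 _ _ hz).2.2, rmul_smul_one]
  · change T y = rmul y (r • (1 : Octonion))
    rw [hy, rmul_smul_one]

/-- An orthonormal family in the slice cone is weak associative orthonormal. -/
theorem IsOctonionOrthonormal.isWeakAssocOrthonormal {ι : Type*} {z : ι → H}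
    (hz : IsOctonionOrthonormal z) (hc : ∀ i, z i ∈ sliceCone H) : IsWeakAssocOrthonormal z := by
  refine ⟨hz, fun p i j => ?_⟩
  change oinner (z i) (z j) * p - oinner (z i) (rmul (z j) p) = 0
  by_cases hij : i = j
  · subst hij
    rw [hz.1, oinner_rmul_self_of_mem_sliceCone (hc i), norm_eq_one_of_oinner_self (hz.1 i),
      one_mul']
    simp
  · rw [oinner_rmul_eq_zero_of_mem_sliceCone (hc i) (hc j) (hz.2 i j hij), hz.2 i j hij,
      Octonion.zero_mul', sub_zero]

/-- The real orthonormal family `z_j e_i` attached to an orthonormal family in the slice cone. -/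
theorem IsOctonionOrthonormal.orthonormal_rmul {ι : Type*} {z : ι → H}
    (hz : IsOctonionOrthonormal z) (hc : ∀ i, z i ∈ sliceCone H) :
    Orthonormal ℝ (fun k : ι × Fin 8 => rmul (z k.1) (e k.2)) := by
  classical
  rw [orthonormal_iff_ite]
  rintro ⟨j, i⟩ ⟨j', i'⟩
  by_cases hj : j = j'
  · subst hj
    rw [inner_rmul_rmul_of_mem_sliceCone (hc j), norm_eq_one_of_oinner_self (hz.1 j),
      e_mul_conj_e_apply_zero]
    simp
  · rw [inner_rmul_rmul_eq_zero_of_mem_sliceCone (hc j) (hc j') (hz.2 j j' hj)]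
    simp [hj]

/-- Expansion of `T x` along a total orthonormal family of strong eigenvectors. -/
theorem IsOctonionOrthonormal.hasSum_smul_sliceProj {ι : Type*} {z : ι → H}
    (hz : IsOctonionOrthonormal z) (hc : ∀ i, z i ∈ sliceCone H)
    (htotal : ∀ x, (∀ i, oinner (z i) x = 0) → x = 0) {T : H →L[ℝ] H} {lam : ι → ℝ}
    (hT : ∀ i p, T (rmul (z i) p) = lam i • rmul (z i) p) (x : H) :
    HasSum (fun i => lam i • sliceProj (z i) x) (T x) := by
  have hon := hz.orthonormal_rmul hc
  have hbot : (Submodule.span ℝ (Set.range fun k : ι × Fin 8 => rmul (z k.1) (e k.2)))ᗮ = ⊥ := by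
    rw [Submodule.eq_bot_iff]
    intro y hy
    refine htotal y fun i => ?_
    ext k
    rw [oinner_apply]
    exact hy _ (Submodule.subset_span ⟨(i, k), rfl⟩)
  let b := HilbertBasis.mkOfOrthogonalEqBot hon hbot
  have hb : ∀ k, b k = rmul (z k.1) (e k.2) := fun k => by
    simp only [b, HilbertBasis.coe_mkOfOrthogonalEqBot]
  have h := (b.hasSum_repr x).mapL T
  refine h.prod_fiberwise fun i => ?_
  have h2 : lam i • sliceProj (z i) x = ∑ k, T (b.repr x (i, k) • b (i, k)) := by
    simp only [map_smul, b.repr_apply_apply, hb, hT, sliceProj_eq_sum, Finset.smul_sum]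
    exact Finset.sum_congr rfl fun k _ => smul_comm _ _ _
  rw [h2]
  exact hasSum_fintype _

end Hilbert

/-! ### The Hilbert-Schmidt theorem -/

theorem mainTheorem3 {H : Type u} [NormedAddCommGroup H] [InnerProductSpace ℝ H]
    [CompleteSpace H] [HilbertOctonionBimodule H] (T : H →L[ℝ] H)
    (hpara : IsParaLinear (T : H →ₗ[ℝ] H))
    (hcompact : IsCompactOperator T)
    (hself : IsOctonionSelfAdjoint T)
    (heig : ∀ r : ℝ, IsOctonionEigenvalue T (r • (1 : Octonion)) →
      IsStandardStrongEigenvalue T (r • (1 : Octonion))) :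
    ∃ (ι κ : Type u) (z : ι → H) (w : κ → H) (lam : ι → ℝ),
      IsWeakAssocOrthonormalBasis (Sum.elim z w) ∧
      Countable ι ∧
      (∀ i, lam i ≠ 0 ∧ IsStrongEigenvector T (lam i • (1 : Octonion)) (z i) ∧
        T (z i) = lam i • z i) ∧
      Tendsto lam cofinite (𝓝 0) ∧
      (∀ a, IsStrongEigenvector T 0 (w a) ∧ T (w a) = 0) ∧
      (∀ i, IsParaLinear (sliceProj (z i)) ∧
        ∀ x, sliceProj (z i) (sliceProj (z i) x) = sliceProj (z i) x) ∧
      ∀ x : H, HasSum (fun i => lam i • sliceProj (z i) x) (T x) := by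
  obtain ⟨s, hs⟩ := exists_isStrongEigensystem heig
  let ι : Type u := {z : H // ∃ r : ℝ, r ≠ 0 ∧ z ∈ s r}
  let κ : Type u := s 0
  let z : ι → H := Subtype.val
  let w : κ → H := Subtype.val
  choose lam hlam0 hlam using fun i : ι => i.2
  let v : ι ⊕ κ → H := Sum.elim z w
  let mu : ι ⊕ κ → ℝ := Sum.elim lam fun _ => 0
  have hv : ∀ j, v j ∈ s (mu j) := by
    rintro (i | a)
    · exact hlam i
    · exact a.2
  have hc : ∀ j, v j ∈ sliceCone H := fun j => hs.mem_sliceCone (hv j)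
  have hnorm : ∀ j, ‖v j‖ = 1 := fun j => hs.norm_eq_one (hv j)
  have hne : ∀ j, v j ≠ 0 := fun j h => by simpa [h] using hnorm j
  have hmix : ∀ (i : ι) (a : κ), z i ≠ w a := by
    intro i a h
    have h1 := hs.map_eq (hlam i)
    have h2 : T (z i) = (0 : ℝ) • z i := h ▸ hs.map_eq a.2
    have h3 : lam i • z i = 0 := by rw [← zero_smul ℝ (z i), ← h2, h1]
    exact (smul_ne_zero (hlam0 i) (hne (Sum.inl i))) h3
  have hinj : Function.Injective v := by
    rintro (i | a) (j | b) h
    · exact congrArg Sum.inl (Subtype.ext h)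
    · exact absurd h (hmix i b)
    · exact absurd h.symm (hmix j a)
    · exact congrArg Sum.inr (Subtype.ext h)
  have hrange : ∀ r, ∀ y ∈ s r, ∃ j, v j = y := by
    intro r y hy
    by_cases hr : r = 0
    · subst hr; exact ⟨Sum.inr ⟨y, hy⟩, rfl⟩
    · exact ⟨Sum.inl ⟨y, r, hr, hy⟩, rfl⟩
  have hon : IsOctonionOrthonormal v :=
    ⟨fun j => (hs.orthonormal (mu j)).1 ⟨v j, hv j⟩, fun j k hjk =>
      hs.oinner_eq_zero hpara hcompact hself (hv j) (hv k) (hinj.ne hjk)⟩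
  have htotal : ∀ x, (∀ j, oinner (v j) x = 0) → x = 0 := by
    intro x hx
    refine hs.eq_zero_of_forall_oinner_eq_zero hcompact hself fun r y hy => ?_
    obtain ⟨j, rfl⟩ := hrange r y hy
    exact hx j
  have htend : Tendsto lam cofinite (𝓝 0) := by
    refine hcompact.tendsto_eigenvalues (v := z) ?_ fun i => hs.map_eq (hlam i)
    refine ⟨fun i => hnorm (Sum.inl i), fun i j hij => ?_⟩
    refine (oinner_apply_zero (z i) (z j)).symm.trans ?_
    exact congrFun (hon.2 (Sum.inl i) (Sum.inl j) (Sum.inl_injective.ne hij)) 0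
  refine ⟨ι, κ, z, w, lam, ⟨hon.isWeakAssocOrthonormal hc, fun S hS hSon => ?_⟩, ?_,
    fun i => ⟨hlam0 i, ⟨hc (Sum.inl i), hne (Sum.inl i), ?_⟩, hs.map_eq (hlam i)⟩, htend,
    fun a => ?_, fun i => ⟨isParaLinear_sliceProj (hc (Sum.inl i)),
      sliceProj_sliceProj (hc (Sum.inl i)) (hnorm (Sum.inl i))⟩, fun x => ?_⟩
  -- Maximality: a further member would be orthogonal to a total family, hence zero, yet has norm
  -- one.
  · refine Set.Subset.antisymm (fun y hy => ?_) hS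
    by_contra hyr
    have hy1 := norm_eq_one_of_oinner_self (hSon.1.1 ⟨y, hy⟩)
    have hy0 : y = 0 := htotal y fun j =>
      hSon.1.2 ⟨v j, hS ⟨j, rfl⟩⟩ ⟨y, hy⟩ fun h => hyr ⟨j, congrArg Subtype.val h⟩
    simp [hy0] at hy1
  -- A family of nonzero reals tending to `0` along the cofinite filter is countable.
  · have h := htend.countable_compl_preimage_ker
    have huniv : (lam ⁻¹' (𝓝 (0 : ℝ)).ker)ᶜ = Set.univ := by
      ext i; simp [hlam0 i]
    rw [huniv] at h
    exact Set.countable_univ_iff.1 h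
  · rw [rmul_smul_one]; exact hs.map_eq (hlam i)
  · have h0 : T (w a) = 0 := by rw [hs.map_eq a.2, zero_smul]
    exact ⟨⟨hc (Sum.inr a), hne (Sum.inr a), by rw [h0, map_zero]⟩, h0⟩
  · have h := hon.hasSum_smul_sliceProj hc htotal (lam := mu)
      (fun j p => hs.map_rmul hpara hcompact hself (hv j) p) x
    refine (Function.Injective.hasSum_iff (f := fun j => mu j • sliceProj (v j) x)
      Sum.inl_injective ?_).2 h
    rintro (i | a) hj
    · exact absurd ⟨i, rfl⟩ hj
    · change (0 : ℝ) • _ = 0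
      rw [zero_smul]
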